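/- **Theorem 1.2.** Let $p\ge 5$ be a prime and let $n$ be a positive integer. For a $p$-adic integer $x$ let $\langle x\rangle_p$ denote the least non-negative integer $r$ with $x\equiv r\pmod p$, and let $$\Gamma_p(x)=\lim_{m\to x}(-1)^m\prod_{\substack{1<k<m\\ (k,p)=1}}k$$ be the $p$-adic Gamma function, where the limit is taken for $m$ tending to $x$ $p$-adically in $\mathbb Z_{\ge 0}$. For a non-negative integer $N$ write $${}_3F_2\left[\begin{matrix}\tfrac12,\,-a,\,a+1\\ 1,\,1\end{matrix};1\right]_N=\sum_{k=0}^{N-1}\frac{\left(\frac12\right)_k(-a)_k(a+1)_k}{(1)_k(1)_k}\cdot\frac{1}{k!},$$ where $(x)_0=1$ and $(x)_k=x(x+1)\cdots(x+k-1)$ for $k\ge1$. For every $a\in\left\{-\frac12,-\frac13,-\frac14,-\frac16\right\}$ with $\langle a\rangle_p\equiv 0\pmod 2$, we have $${}_3F_2\left[\begin{matrix}\tfrac12,\,-a,\,a+1\\ 1,\,1\end{matrix};1\right]_{np}\equiv(-1)^{\frac{p+1}{2}}\,\Gamma_p\left(-\frac a2\right)^2\Gamma_p\left(\frac{a+1}2\right)^2\;{}_3F_2\left[\begin{matrix}\tfrac12,\,-a,\,a+1\\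 1,\,1\end{matrix};1\right]_{n}\pmod{p^2},$$ a congruence between $p$-adic integers, that is, in $\mathbb Z_p$. -/

import Mathlib

/-- The truncated hypergeometric series
`∑_{k=0}^{n-1} (a₁)_k ⋯ (a_r)_k / ((b₁)_k ⋯ (b_s)_k) * z^k / k!`, where `(x)_k` is the rising
factorial. As usual it is meant for lower parameters `b_j` that are not non-positive integers. -/
noncomputable def truncatedHypergeometric {K : Type*} [Field K] (as bs : List K) (z : K)
    (n : ℕ) : K :=
  ∑ k ∈ Finset.range n,
    (as.map fun x => (ascPochhammer K k).eval x).prod /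
      (bs.map fun x => (ascPochhammer K k).eval x).prod * (z ^ k / (k.factorial : K))

/-- `x ≡ y (mod p ^ m)` for `p`-adic integers `x`, `y` given as elements of `ℚ_[p]`; that `x` and
`y` lie in `ℤ_[p]` is part of the assertion. -/
def PadicCongr (p : ℕ) [Fact p.Prime] (m : ℕ) (x y : ℚ_[p]) : Prop :=
  ∃ u v : ℤ_[p], (u : ℚ_[p]) = x ∧ (v : ℚ_[p]) = y ∧ (p : ℤ_[p]) ^ m ∣ u - v

/-- `⟨a⟩_p`: the least non-negative integer `r` with `a ≡ r (mod p)`, for a `p`-adic integer `a`. -/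
noncomputable def leastResidue (p : ℕ) [Fact p.Prime] (a : ℚ_[p]) : ℕ :=
  sInf {r : ℕ | PadicCongr p 1 a (r : ℚ_[p])}

/-- `(-1)^m * ∏_{1 < k < m, (k, p) = 1} k`. -/
def padicGammaNat (p m : ℕ) : ℤ :=
  (-1) ^ m * ∏ k ∈ (Finset.Ioo 1 m).filter (fun k => Nat.Coprime k p), (k : ℤ)

/-- The `p`-adic Gamma function: for a `p`-adic integer `x`,
`Γ_p(x) = lim (-1)^m ∏_{1 < k < m, (k, p) = 1} k`, the limit being taken as `m` tends to `x`
`p`-adically through the non-negative integers. It is meant only for `x` in `ℤ_[p]`; see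
`tendsto_padicGamma` for the existence of the limit when `p` is odd. -/
noncomputable def padicGamma (p : ℕ) [Fact p.Prime] (x : ℚ_[p]) : ℚ_[p] :=
  Filter.limUnder (Filter.comap (fun m : ℕ => (m : ℚ_[p])) (nhds x))
    (fun m : ℕ => (padicGammaNat p m : ℚ_[p]))

theorem ZMod.prod_units_prime_pow {p k : ℕ} (hp : p.Prime) (hp2 : p ≠ 2) (hk : k ≠ 0)
    [Fintype (ZMod (p ^ k))ˣ] :
    ∏ u : (ZMod (p ^ k))ˣ, u = -1 := by
  classical
  have h3 : 3 ≤ p := by have := hp.two_le; omega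
  have hN : 2 < p ^ k := lt_of_lt_of_le (by omega) (Nat.le_self_pow hk p)
  have : Fact (2 < p ^ k) := ⟨hN⟩
  have : NeZero (p ^ k) := ⟨by omega⟩
  have hne : (1 : (ZMod (p ^ k))ˣ) ≠ -1 := by
    intro h
    have h' := congrArg (fun u : (ZMod (p ^ k))ˣ => (u : ZMod (p ^ k))) h
    simp only [Units.val_one, Units.val_neg] at h'
    exact ZMod.neg_one_ne_one h'.symm
  have hfix : ∀ u : (ZMod (p ^ k))ˣ, u * u = 1 → u = 1 ∨ u = -1 := by
    intro u hu
    obtain ⟨x, hx⟩ := ZMod.intCast_surjective (u : ZMod (p ^ k))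
    have h1 : (x : ZMod (p ^ k)) * x = 1 := by
      rw [hx, ← Units.val_mul, hu, Units.val_one]
    have h2 : ((p ^ k : ℕ) : ℤ) ∣ (x - 1) * (x + 1) := by
      rw [← ZMod.intCast_zmod_eq_zero_iff_dvd]
      push_cast
      linear_combination h1
    have hpz : Prime (p : ℤ) := Nat.prime_iff_prime_int.mp hp
    push_cast at h2
    by_cases hd : (p : ℤ) ∣ x - 1
    · left
      have hnd : ¬ (p : ℤ) ∣ x + 1 := by
        intro h
        have h4 : (p : ℤ) ∣ 2 := by
          have := dvd_sub h hd
          ring_nf at this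
          exact this
        have := Int.le_of_dvd (by norm_num) h4
        omega
      have h5 := (hpz.pow_dvd_of_dvd_mul_right k hnd h2)
      have h6 : ((x - 1 : ℤ) : ZMod (p ^ k)) = 0 := by
        rw [ZMod.intCast_zmod_eq_zero_iff_dvd]; exact_mod_cast h5
      ext
      rw [← hx, Units.val_one]
      push_cast at h6
      linear_combination h6
    · right
      have h5 := (hpz.pow_dvd_of_dvd_mul_left k hd h2)
      have h6 : ((x + 1 : ℤ) : ZMod (p ^ k)) = 0 := by
        rw [ZMod.intCast_zmod_eq_zero_iff_dvd]; exact_mod_cast h5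
      ext
      rw [← hx, Units.val_neg, Units.val_one]
      push_cast at h6
      linear_combination h6
  have hrest : ∏ u ∈ (Finset.univ : Finset (ZMod (p ^ k))ˣ) \ {1, -1}, u = 1 := by
    refine Finset.prod_involution (fun u _ => u⁻¹) ?_ ?_ ?_ ?_
    · intro u _; simp
    · intro u hu _ h
      simp only [Finset.mem_sdiff, Finset.mem_univ, true_and, Finset.mem_insert,
        Finset.mem_singleton] at hu
      exact hu (hfix u (by nth_rewrite 1 [← h]; simp))
    · intro u hu
      simp only [Finset.mem_sdiff, Finset.mem_univ, true_and, Finset.mem_insert,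
        Finset.mem_singleton, not_or] at hu ⊢
      refine ⟨fun h => hu.1 (inv_eq_one.mp h), fun h => hu.2 ?_⟩
      rw [← inv_inv u, h]; simp
    · intro u _; simp
  rw [← Finset.prod_sdiff (Finset.subset_univ ({1, -1} : Finset (ZMod (p ^ k))ˣ)), hrest,
    Finset.prod_pair hne]
  simp

theorem padicGammaNat_eq {p : ℕ} (hp : p.Prime) (m : ℕ) :
    padicGammaNat p m = ∏ k ∈ Finset.range m, (-(if Nat.Coprime k p then (k : ℤ) else 1)) := by
  rw [Finset.prod_neg, Finset.card_range, padicGammaNat, ← Finset.prod_filter]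
  congr 1
  refine Finset.prod_subset ?_ ?_
  · intro k hk
    simp only [Finset.mem_filter, Finset.mem_Ioo, Finset.mem_range] at hk ⊢
    exact ⟨hk.1.2, hk.2⟩
  · intro k hk hk'
    simp only [Finset.mem_filter, Finset.mem_Ioo, Finset.mem_range] at hk hk'
    have h0 : k ≠ 0 := by
      rintro rfl
      exact hp.one_lt.ne' (by simpa using hk.2)
    have : k = 1 := by
      by_contra h1
      exact hk' ⟨⟨by omega, hk.1⟩, hk.2⟩
    simp [this]

theorem padicGammaNat_add {p : ℕ} (hp : p.Prime) (hp2 : p ≠ 2) {k : ℕ} (hk : k ≠ 0) (m : ℕ) :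
    (padicGammaNat p (m + p ^ k) : ZMod (p ^ k)) = (padicGammaNat p m : ZMod (p ^ k)) := by
  classical
  have : NeZero (p ^ k) := ⟨(pow_pos hp.pos k).ne'⟩
  let f : ZMod (p ^ k) → ZMod (p ^ k) := fun x => -(if IsUnit x then x else 1)
  have hf : ∀ x, IsUnit (f x) := by
    intro x
    by_cases h : IsUnit x <;> simp [f, h]
  have hg : ∀ m : ℕ, (padicGammaNat p m : ZMod (p ^ k)) = ∏ j ∈ Finset.range m, f (j : ℕ) := by
    intro m
    rw [padicGammaNat_eq hp, Int.cast_prod]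
    refine Finset.prod_congr rfl fun j _ => ?_
    have : IsUnit (j : ZMod (p ^ k)) ↔ Nat.Coprime j p := by
      rw [ZMod.isUnit_iff_coprime, Nat.coprime_pow_right_iff (Nat.pos_of_ne_zero hk)]
    simp only [f, this]
    split_ifs <;> simp
  have hblock0 : ∏ j ∈ Finset.range (p ^ k), f (j : ℕ) = 1 := by
    have e1 : ∏ j ∈ Finset.range (p ^ k), f (j : ℕ) = ∏ x : ZMod (p ^ k), f x := by
      refine Finset.prod_bij (fun j _ => (j : ZMod (p ^ k))) (fun _ _ => Finset.mem_univ _) ?_ ?_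
        (fun _ _ => rfl)
      · intro a ha b hb hab
        rw [Finset.mem_range] at ha hb
        have := (ZMod.natCast_eq_natCast_iff' a b _).mp hab
        rwa [Nat.mod_eq_of_lt ha, Nat.mod_eq_of_lt hb] at this
      · intro x _
        exact ⟨x.val, Finset.mem_range.mpr (ZMod.val_lt x), ZMod.natCast_zmod_val x⟩
    have e2 : ∏ x : ZMod (p ^ k), (if IsUnit x then x else 1) = -1 := by
      rw [← Finset.prod_filter]
      have := congrArg (fun u : (ZMod (p ^ k))ˣ => (u : ZMod (p ^ k)))
        (ZMod.prod_units_prime_pow hp hp2 hk)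
      simp only [Units.coe_prod, Units.val_neg, Units.val_one] at this
      rw [← this]
      symm
      refine Finset.prod_bij (fun u _ => (u : ZMod (p ^ k))) ?_ ?_ ?_ (fun _ _ => rfl)
      · intro u _; simp
      · intro a _ b _ h; exact Units.ext h
      · intro x hx
        obtain ⟨u, hu⟩ := (Finset.mem_filter.mp hx).2
        exact ⟨u, Finset.mem_univ _, hu⟩
    rw [e1]
    simp only [f]
    rw [Finset.prod_neg, e2, Finset.card_univ, ZMod.card,
      ((hp.odd_of_ne_two hp2).pow).neg_one_pow]
    ring
  have hblock : ∀ m : ℕ, ∏ j ∈ Finset.range (p ^ k), f ((m + j : ℕ)) = 1 := by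
    intro m
    induction m with
    | zero => simpa using hblock0
    | succ m ih =>
      have h1 := Finset.prod_range_succ (fun j => f ((m + j : ℕ))) (p ^ k)
      rw [Finset.prod_range_succ', ih, one_mul] at h1
      have h2 : ((m + p ^ k : ℕ) : ZMod (p ^ k)) = ((m + 0 : ℕ) : ZMod (p ^ k)) := by
        simp
      rw [h2] at h1
      have h3 := (hf ((m + 0 : ℕ) : ZMod (p ^ k))).mul_right_cancel
        (h1.trans (one_mul _).symm)
      rw [← h3]
      refine Finset.prod_congr rfl fun j _ => ?_
      congr 2
      omega
  rw [hg, hg, Finset.prod_range_add, hblock, mul_one]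

theorem padicGammaNat_congr {p : ℕ} (hp : p.Prime) (hp2 : p ≠ 2) {k : ℕ} (hk : k ≠ 0) {m n : ℕ}
    (h : m ≡ n [MOD p ^ k]) : ((p ^ k : ℕ) : ℤ) ∣ padicGammaNat p m - padicGammaNat p n := by
  have key : ∀ m t : ℕ, (padicGammaNat p (m + p ^ k * t) : ZMod (p ^ k)) =
      (padicGammaNat p m : ZMod (p ^ k)) := by
    intro m t
    induction t with
    | zero => simp
    | succ t ih => rw [mul_add, mul_one, ← add_assoc, padicGammaNat_add hp hp2 hk, ih]
  rw [← ZMod.intCast_zmod_eq_zero_iff_dvd, Int.cast_sub, sub_eq_zero]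
  have hm := key (m % p ^ k) (m / p ^ k)
  have hn := key (n % p ^ k) (n / p ^ k)
  rw [Nat.mod_add_div] at hm hn
  rw [hm, hn, h]

/-- For odd `p` the limit that defines `Γ_p` exists at every `p`-adic integer. -/
theorem tendsto_padicGamma (p : ℕ) [hp : Fact p.Prime] (hp2 : p ≠ 2) (x : ℤ_[p]) :
    Filter.Tendsto (fun m : ℕ => (padicGammaNat p m : ℚ_[p]))
      (Filter.comap (fun m : ℕ => (m : ℚ_[p])) (nhds (x : ℚ_[p])))
      (nhds (padicGamma p (x : ℚ_[p]))) := by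
  have hp1 : (1 : ℝ) < p := by exact_mod_cast hp.out.one_lt
  refine tendsto_nhds_limUnder (g := fun m : ℕ => (padicGammaNat p m : ℚ_[p]))
    (CompleteSpace.complete (f := Filter.map (fun m : ℕ => (padicGammaNat p m : ℚ_[p])) _) ?_)
  have hne : (Filter.comap (fun m : ℕ => (m : ℚ_[p])) (nhds (x : ℚ_[p]))).NeBot := by
    rw [Filter.comap_neBot_iff]
    intro t ht
    obtain ⟨ε, hε, hball⟩ := Metric.mem_nhds_iff.mp ht
    obtain ⟨n, hn⟩ := PadicInt.denseRange_natCast.exists_dist_lt x hε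
    refine ⟨n, hball ?_⟩
    rw [Metric.mem_ball, dist_comm]
    exact_mod_cast hn
  rw [Metric.cauchy_iff]
  refine ⟨hne.map _, fun ε hε => ?_⟩
  obtain ⟨k, hk⟩ := PadicInt.exists_pow_neg_lt p hε
  have hkpos : (0 : ℝ) < (p : ℝ) ^ (-((k + 1 : ℕ) : ℤ)) := by positivity
  have hkε : (p : ℝ) ^ (-((k + 1 : ℕ) : ℤ)) < ε :=
    lt_of_le_of_lt (zpow_le_zpow_right₀ hp1.le (by push_cast; omega)) hk
  refine ⟨_, Filter.image_mem_map (Filter.preimage_mem_comap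
    (Metric.ball_mem_nhds (x : ℚ_[p]) hkpos)), ?_⟩
  rintro _ ⟨m, hm, rfl⟩ _ ⟨n, hn, rfl⟩
  rw [Set.mem_preimage, Metric.mem_ball] at hm hn
  have hmn : ‖(((m : ℤ) - (n : ℤ) : ℤ) : ℚ_[p])‖ ≤ (p : ℝ) ^ (-((k + 1 : ℕ) : ℤ)) := by
    have h1 : (((m : ℤ) - (n : ℤ) : ℤ) : ℚ_[p]) = ((m : ℚ_[p]) - x) + -((n : ℚ_[p]) - x) := by
      push_cast; ring
    rw [h1]
    refine (Padic.nonarchimedean _ _).trans (max_le ?_ ?_)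
    · rw [← dist_eq_norm]; exact hm.le
    · rw [norm_neg, ← dist_eq_norm]; exact hn.le
  have hd : m ≡ n [MOD p ^ (k + 1)] := by
    have h2 := (Padic.norm_int_le_pow_iff_dvd _ _).mp hmn
    refine ((Nat.modEq_iff_dvd).mpr ?_).symm
    exact_mod_cast h2
  have hG := padicGammaNat_congr hp.out hp2 (Nat.succ_ne_zero k) hd
  refine lt_of_le_of_lt ?_ hkε
  rw [dist_eq_norm, ← Int.cast_sub]
  refine (Padic.norm_int_le_pow_iff_dvd _ _).mpr ?_
  exact_mod_cast hG

/-! Write S(x, N) for the sum over k < N of (1/2)_k (-x)_k (x+1)_k / k!^3, and put h = (p-1)/2, H =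
1 + 1/2 + ⋯ + 1/h. Each (x)_k / k! is `multichoose x k`, which exists in ℤ_p, so every congruence
can be proved in ℤ_p without denominators.

Let a = -1/d and a = pτ + 2M with 2M the least residue of a. Since p ≡ ±1 (mod d), τ is a or -1 - a,
and S is invariant under x ↦ -1 - x, so S(τ, n) = S(a, n). Three facts then combine.

Shift (`hyperSum_recurrence`, `toZModPow_two_hyperSum_shift`): (x+2)^2 S(x+2, N) and (x+1)^2 S(x, N)
differ by a term carrying N^3, which vanishes mod p^2 at N = np. After M steps from pτ to a, the
ratio S(a, np) / S(pτ, np) is the square of ∏ (pτ+2i+1) / (pτ+2i+2) over i < M.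

Reduction (`toZModPow_two_hyperSum_mul`): S(pτ, np) ≡ (1 + pτH) S(τ, n). The term at jp is the j-th
term for τ times 1 + pjH. The terms strictly between jp and (j+1)p are divisible by p and together
contribute -p(j-τ)H times the term at jp.

Gamma values (`toZModPow_two_hyperSum_gamma`): mod p^2 the arguments -a/2 and (a+1)/2 are replaced
by natural numbers, and Γ_p becomes a finite product. The factors near multiples of p reproduce the
shift products, and the remaining blocks give ±(1 + pτH) by Wilson's theorem. -/

/-! ### Rising factorials and multichoose -/

/-- The rising factorial `x (x + 1) ⋯ (x + k - 1)`. -/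
def risingProd {R : Type*} [CommSemiring R] (x : R) (k : ℕ) : R :=
  ∏ i ∈ Finset.range k, (x + i)

section RisingProd

variable {R : Type*} [CommRing R]

theorem ascPochhammer_eval_eq_risingProd (x : R) (k : ℕ) :
    (ascPochhammer R k).eval x = risingProd x k := by
  induction k with
  | zero => simp [risingProd]
  | succ k ih =>
    rw [ascPochhammer_succ_eval, ih, risingProd, risingProd, Finset.prod_range_succ]

@[simp]
theorem risingProd_zero (x : R) : risingProd x 0 = 1 := by simp [risingProd]

theorem risingProd_succ (x : R) (k : ℕ) : risingProd x (k + 1) = risingProd x k * (x + k) :=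
  Finset.prod_range_succ _ _

theorem risingProd_succ' (x : R) (k : ℕ) : risingProd x (k + 1) = x * risingProd (x + 1) k := by
  rw [risingProd, Finset.prod_range_succ', mul_comm, Nat.cast_zero, add_zero]
  congr 1
  refine Finset.prod_congr rfl fun i _ => ?_
  push_cast; ring

theorem risingProd_add (x : R) (k l : ℕ) :
    risingProd x (k + l) = risingProd x k * risingProd (x + k) l := by
  rw [risingProd, Finset.prod_range_add]
  congr 1
  refine Finset.prod_congr rfl fun i _ => ?_
  push_cast; ring

theorem risingProd_one (k : ℕ) : risingProd (1 : R) k = (k.factorial : R) := by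
  induction k with
  | zero => simp
  | succ k ih => rw [risingProd_succ, ih, Nat.factorial_succ]; push_cast; ring

/-- The product is read backwards, with one sign taken out of each factor. -/
theorem risingProd_neg_reflect (x : R) (k : ℕ) :
    risingProd (-x - k) k = (-1) ^ k * risingProd (x + 1) k := by
  rw [risingProd, ← Finset.prod_range_reflect, risingProd]
  have : (-1 : R) ^ k = ∏ _i ∈ Finset.range k, (-1 : R) := by simp
  rw [this, ← Finset.prod_mul_distrib]
  refine Finset.prod_congr rfl fun i hi => ?_
  have hi := Finset.mem_range.mp hi
  rw [Nat.cast_sub (by omega), Nat.cast_sub (by omega)]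
  push_cast; ring

theorem map_risingProd {S : Type*} [CommRing S] (f : R →+* S) (x : R) (k : ℕ) :
    f (risingProd x k) = risingProd (f x) k := by
  simp [risingProd, map_prod]

end RisingProd

section Multichoose

open Ring

variable {R : Type*} [CommRing R] [BinomialRing R]

theorem factorial_mul_multichoose (x : R) (k : ℕ) :
    (k.factorial : R) * multichoose x k = risingProd x k := by
  rw [← nsmul_eq_mul, factorial_nsmul_multichoose_eq_ascPochhammer,
    Polynomial.ascPochhammer_smeval_eq_eval, ascPochhammer_eval_eq_risingProd]

/-- A binomial ring is torsion-free, so identities between binomial coefficients may be checked on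
rising factorials. -/
theorem factorial_mul_cancel {x y : R} (k : ℕ)
    (h : (k.factorial : R) * x = (k.factorial : R) * y) : x = y := by
  have : IsAddTorsionFree R := BinomialRing.toIsAddTorsionFree
  rw [← nsmul_eq_mul, ← nsmul_eq_mul] at h
  exact nsmul_right_injective (Nat.factorial_ne_zero k) h

theorem succ_mul_multichoose_succ (x : R) (k : ℕ) :
    ((k : R) + 1) * multichoose x (k + 1) = (x + k) * multichoose x k := by
  apply factorial_mul_cancel k
  have h1 := factorial_mul_multichoose x (k + 1)
  rw [risingProd_succ, ← factorial_mul_multichoose x k, Nat.factorial_succ] at h1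
  push_cast at h1
  linear_combination h1

theorem mul_multichoose_add_one (x : R) (k : ℕ) :
    x * multichoose (x + 1) k = (x + k) * multichoose x k := by
  apply factorial_mul_cancel k
  have h1 := risingProd_succ x k
  rw [risingProd_succ', ← factorial_mul_multichoose x k, ← factorial_mul_multichoose (x + 1) k]
    at h1
  linear_combination h1

theorem risingProd_mul_multichoose_add (x : R) (k l : ℕ) :
    risingProd ((k : R) + 1) l * multichoose x (k + l) =
      multichoose x k * risingProd (x + k) l := by
  apply factorial_mul_cancel k
  have h1 := factorial_mul_multichoose x (k + l)
  rw [← risingProd_one, risingProd_add, risingProd_add, ← factorial_mul_multichoose x k,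
    risingProd_one, add_comm (1 : R)] at h1
  linear_combination h1

/-- The general term of the series `₃F₂[s, -x, x + 1; 1, 1; 1]`. -/
noncomputable def hyperTerm (s x : R) (k : ℕ) : R :=
  multichoose s k * multichoose (-x) k * multichoose (x + 1) k

/-- The truncated series `₃F₂[s, -x, x + 1; 1, 1; 1]_N`. -/
noncomputable def hyperSum (s x : R) (N : ℕ) : R :=
  ∑ k ∈ Finset.range N, hyperTerm s x k

theorem hyperSum_reflect (s x : R) (N : ℕ) : hyperSum s (-1 - x) N = hyperSum s x N := by
  refine Finset.sum_congr rfl fun k _ => ?_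
  rw [hyperTerm, hyperTerm, show -(-1 - x) = x + 1 by ring, show -1 - x + 1 = -x by ring]
  ring

/-- A creative-telescoping identity: the right side is the certificate, and induction on N only
compares its increment with the new summand. The factor (x+1)(x+2) clears the denominators that
appear when the summands at x and x+2 are expressed through one common product. -/
theorem hyperSum_recurrence {s : R} (hs : 2 * s = 1) (x : R) (N : ℕ) :
    (x + 1) * (x + 2) *
        ((x + 2) ^ 2 * hyperSum s (x + 2) N - (x + 1) ^ 2 * hyperSum s x N) =
      -2 * (2 * x + 3) * (N : R) ^ 3 *
        (multichoose s N * multichoose (-x - 2) N * multichoose (x + 1) N) := by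
  induction N with
  | zero => simp [hyperSum]
  | succ N ih =>
    have e1 := succ_mul_multichoose_succ s N
    have e2 := succ_mul_multichoose_succ (-x - 2) N
    have e3 := succ_mul_multichoose_succ (x + 1) N
    have f1 := mul_multichoose_add_one (x + 1) N
    have f2 := mul_multichoose_add_one (x + 2) N
    have g1 := mul_multichoose_add_one (-x - 2) N
    have g2 := mul_multichoose_add_one (-x - 1) N
    rw [show x + 1 + 1 = x + 2 by ring] at f1
    rw [show x + 2 + 1 = x + 3 by ring] at f2
    rw [show -x - 2 + 1 = -x - 1 by ring] at g1
    rw [show -x - 1 + 1 = -x by ring] at g2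
    -- `F` and `G` reduce both new summands to the common product; `E` advances the certificate from
    -- N to N + 1.
    have F : (x + 1) * (x + 2) * multichoose (x + 3) N =
        (x + 1 + N) * (x + 2 + N) * multichoose (x + 1) N := by
      linear_combination (x + 1) * f2 + (x + 2 + N) * f1
    have G : (x + 1) * (x + 2) * multichoose (-x) N =
        (-x - 2 + N) * (-x - 1 + N) * multichoose (-x - 2) N := by
      linear_combination (-x - 2) * g2 + (-x - 1 + N) * g1
    have E : ((N : R) + 1) ^ 3 * (multichoose s (N + 1) * multichoose (-x - 2) (N + 1) *
        multichoose (x + 1) (N + 1)) = (s + N) * (-x - 2 + N) * (x + 1 + N) *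
        (multichoose s N * multichoose (-x - 2) N * multichoose (x + 1) N) := by
      calc _ = (((N : R) + 1) * multichoose s (N + 1)) *
            (((N : R) + 1) * multichoose (-x - 2) (N + 1)) *
            (((N : R) + 1) * multichoose (x + 1) (N + 1)) := by ring
        _ = _ := by rw [e1, e2, e3]; ring
    have hS : ∀ y, hyperSum s y (N + 1) = hyperSum s y N + hyperTerm s y N :=
      fun y => Finset.sum_range_succ _ _
    rw [hS, hS, hyperTerm, hyperTerm, show -(x + 2) = -x - 2 by ring,
      show x + 2 + 1 = x + 3 by ring]
    push_cast
    have D : (x + 1) * (x + 2) * ((x + 2) ^ 2 * (multichoose s N * multichoose (-x - 2) N *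
          multichoose (x + 3) N) - (x + 1) ^ 2 * (multichoose s N * multichoose (-x) N *
          multichoose (x + 1) N)) =
        ((x + 2) ^ 2 * ((x + 1 + N) * (x + 2 + N)) - (x + 1) ^ 2 *
          ((-x - 2 + N) * (-x - 1 + N))) *
        (multichoose s N * multichoose (-x - 2) N * multichoose (x + 1) N) := by
      linear_combination (x + 2) ^ 2 * multichoose s N * multichoose (-x - 2) N * F -
        (x + 1) ^ 2 * multichoose s N * multichoose (x + 1) N * G
    linear_combination ih + D + 2 * (2 * x + 3) * E + (2 * x + 3) * (-x - 2 + N) * (x + 1 + N) *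
        (multichoose s N * multichoose (-x - 2) N * multichoose (x + 1) N) * hs

theorem multichoose_neg_natCast (h r : ℕ) :
    multichoose (-(h : R)) r = (-1) ^ r * (h.choose r : R) := by
  induction r with
  | zero => simp
  | succ r ih =>
    have : IsAddTorsionFree R := BinomialRing.toIsAddTorsionFree
    refine nsmul_right_injective (Nat.succ_ne_zero r) ?_
    have e := succ_mul_multichoose_succ (-(h : R)) r
    simp only [nsmul_eq_mul]
    push_cast
    rw [e, ih]
    rcases le_or_gt r h with hr | hr
    · have := congrArg (Nat.cast (R := R)) (Nat.choose_succ_right_eq h r)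
      push_cast [Nat.cast_sub hr] at this
      linear_combination (-1) ^ r * this
    · rw [Nat.choose_eq_zero_of_lt hr, Nat.choose_eq_zero_of_lt (by omega : h < r + 1)]
      simp

end Multichoose

/-- `∑_{r=1}^{N} (-1)^r C(h, r) / r = -(1 + 1/2 + ⋯ + 1/h)`, in a field in which `1, …, N` are
nonzero. -/
theorem sum_neg_one_pow_choose_div {F : Type*} [Field F] {N : ℕ}
    (hN : ∀ k < N, ((k : F) + 1) ≠ 0) (h : ℕ) (hh : h ≤ N) :
    ∑ r ∈ Finset.range N, (-1) ^ (r + 1) * (h.choose (r + 1) : F) / ((r : F) + 1) =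
      -∑ k ∈ Finset.range h, ((k : F) + 1)⁻¹ := by
  induction h with
  | zero => simp
  | succ h ih =>
    have hne := hN h (by omega)
    -- This is (1 - 1)^(h+1) = 0 without its constant term. Passing from h to h + 1 adds C(h,
    -- r)/(r+1) = C(h+1, r+1)/(h+1) to each coefficient, hence this sum over h + 1.
    have alt : ∑ r ∈ Finset.range N, (-1 : F) ^ (r + 1) * ((h + 1).choose (r + 1) : F) = -1 := by
      have h1 := Int.alternating_sum_range_choose_of_ne (Nat.succ_ne_zero h)
      have h2 : ∑ m ∈ Finset.range (N + 1), ((-1 : ℤ) ^ m * ((h + 1).choose m : ℤ)) = 0 := by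
        rw [← h1]
        symm
        refine Finset.sum_subset ?_ ?_
        · intro k hk; simp only [Finset.mem_range] at hk ⊢; omega
        · intro k _ hk
          simp only [Finset.mem_range] at hk
          rw [Nat.choose_eq_zero_of_lt (by omega)]; simp
      rw [Finset.sum_range_succ'] at h2
      have h3 := congrArg (Int.cast (R := F)) h2
      push_cast at h3
      simp only [Nat.choose_zero_right, Nat.cast_one, mul_one] at h3
      linear_combination h3
    rw [Finset.sum_range_succ, neg_add, ← ih (by omega)]
    have step : ∀ r ∈ Finset.range N,
        (-1 : F) ^ (r + 1) * ((h + 1).choose (r + 1) : F) / ((r : F) + 1) =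
        (-1) ^ (r + 1) * (h.choose (r + 1) : F) / ((r : F) + 1) +
          ((h : F) + 1)⁻¹ * ((-1) ^ (r + 1) * ((h + 1).choose (r + 1) : F)) := by
      intro r hr
      have hr := hN r (Finset.mem_range.mp hr)
      have h1 := congrArg (Nat.cast (R := F)) (Nat.add_one_mul_choose_eq h r)
      have h2 := congrArg (Nat.cast (R := F)) (Nat.choose_succ_succ h r)
      push_cast at h1 h2
      field_simp
      linear_combination ((h : F) + 1) * h2 + h1
    rw [Finset.sum_congr rfl step, Finset.sum_add_distrib, ← Finset.mul_sum, alt]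
    ring

/-! ### Arithmetic modulo `p ^ 2` -/

section ModSq

open Ring

variable {p : ℕ} [hp : Fact p.Prime]

theorem toZModPow_eq_iff (m : ℕ) (x y : ℤ_[p]) :
    PadicInt.toZModPow m x = PadicInt.toZModPow m y ↔ (p : ℤ_[p]) ^ m ∣ x - y := by
  rw [← sub_eq_zero, ← map_sub, ← RingHom.mem_ker, PadicInt.ker_toZModPow,
    Ideal.mem_span_singleton]

theorem toZMod_eq_iff (x y : ℤ_[p]) :
    PadicInt.toZMod x = PadicInt.toZMod y ↔ (p : ℤ_[p]) ∣ x - y := by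
  rw [← sub_eq_zero, ← map_sub, ← RingHom.mem_ker, PadicInt.ker_toZMod,
    PadicInt.maximalIdeal_eq_span_p, Ideal.mem_span_singleton]

theorem toZModPow_two_p_sq : (PadicInt.toZModPow 2 (p : ℤ_[p])) ^ 2 = 0 := by
  rw [← map_pow, ← map_zero (PadicInt.toZModPow 2), toZModPow_eq_iff]
  simp

/-- Once a factor p is visible, the cofactor matters only mod p. -/
theorem toZModPow_two_p_mul {x y : ℤ_[p]} (h : PadicInt.toZMod x = PadicInt.toZMod y) :
    PadicInt.toZModPow 2 ((p : ℤ_[p]) * x) = PadicInt.toZModPow 2 ((p : ℤ_[p]) * y) := by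
  rw [toZModPow_eq_iff, ← mul_sub, sq]
  exact mul_dvd_mul_left _ ((toZMod_eq_iff x y).mp h)

theorem isUnit_iff_toZMod_ne_zero (x : ℤ_[p]) : IsUnit x ↔ PadicInt.toZMod x ≠ 0 := by
  rw [← not_iff_not, not_not, ← RingHom.mem_ker, PadicInt.ker_toZMod,
    IsLocalRing.mem_maximalIdeal, mem_nonunits_iff]

theorem natCast_zmod_ne_zero {k : ℕ} (h0 : 0 < k) (hk : k < p) : (k : ZMod p) ≠ 0 := by
  rw [Ne, ZMod.natCast_eq_zero_iff]
  exact Nat.not_dvd_of_pos_of_lt h0 hk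

theorem isUnit_natCast {k : ℕ} (h0 : 0 < k) (hk : k < p) : IsUnit (k : ℤ_[p]) := by
  rw [isUnit_iff_toZMod_ne_zero, map_natCast]
  exact natCast_zmod_ne_zero h0 hk

theorem isUnit_factorial {k : ℕ} (hk : k < p) : IsUnit (k.factorial : ℤ_[p]) := by
  rw [isUnit_iff_toZMod_ne_zero, map_natCast, Ne, ZMod.natCast_eq_zero_iff,
    hp.out.dvd_factorial]
  omega

/-- The harmonic number `1 + 1/2 + ⋯ + 1/h` as a `p`-adic integer, for `h < p`. -/
noncomputable def padicHarmonic (p : ℕ) [Fact p.Prime] (h : ℕ) : ℤ_[p] :=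
  ∑ k ∈ Finset.range h, Ring.inverse ((k : ℤ_[p]) + 1)

theorem padicHarmonic_succ (h : ℕ) :
    padicHarmonic p (h + 1) = padicHarmonic p h + Ring.inverse ((h : ℤ_[p]) + 1) :=
  Finset.sum_range_succ _ _

theorem succ_mul_inverse {k : ℕ} (hk : k + 1 < p) :
    ((k : ℤ_[p]) + 1) * Ring.inverse ((k : ℤ_[p]) + 1) = 1 := by
  have := isUnit_natCast (p := p) (Nat.succ_pos k) hk
  push_cast at this
  exact Ring.mul_inverse_cancel _ this

theorem toZMod_padicHarmonic {h : ℕ} (hh : h < p) :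
    PadicInt.toZMod (padicHarmonic p h) = ∑ k ∈ Finset.range h, ((k : ZMod p) + 1)⁻¹ := by
  rw [padicHarmonic, map_sum]
  refine Finset.sum_congr rfl fun k hk => ?_
  have hk := Finset.mem_range.mp hk
  have := congrArg (PadicInt.toZMod (p := p)) (succ_mul_inverse (p := p) (k := k) (by omega))
  simp only [map_mul, map_add, map_natCast, map_one] at this
  exact (inv_eq_of_mul_eq_one_right this).symm

theorem toZModPow_two_risingProd {h : ℕ} (hh : h < p) (v : ℤ_[p]) :
    PadicInt.toZModPow 2 (risingProd ((p : ℤ_[p]) * v + 1) h) =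
      PadicInt.toZModPow 2 ((h.factorial : ℤ_[p]) * (1 + (p : ℤ_[p]) * v * padicHarmonic p h)) := by
  induction h with
  | zero => simp [padicHarmonic]
  | succ h ih =>
    have ih := ih (by omega)
    have hw := congrArg (PadicInt.toZModPow 2) (succ_mul_inverse (p := p) hh)
    rw [risingProd_succ, map_mul, ih, Nat.factorial_succ, padicHarmonic_succ]
    have hε := toZModPow_two_p_sq (p := p)
    simp only [map_mul, map_add, map_one, Nat.cast_mul, Nat.cast_succ] at hw ⊢
    -- What remains is a polynomial identity in which the image ε of p satisfies ε^2 = 0.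
    generalize PadicInt.toZModPow 2 (p : ℤ_[p]) = ε at *
    generalize PadicInt.toZModPow 2 (Ring.inverse ((h : ℤ_[p]) + 1)) = w at *
    generalize PadicInt.toZModPow 2 (padicHarmonic p h) = H at *
    generalize PadicInt.toZModPow 2 v = v at *
    generalize PadicInt.toZModPow 2 (h.factorial : ℤ_[p]) = f at *
    generalize PadicInt.toZModPow 2 (h : ℤ_[p]) = h at *
    linear_combination (-f * ε * v) * hw + f * v ^ 2 * H * hε

/-- Reflecting the upper half of the block gives (1 + pvH)(1 - p(v+1)H) ≡ 1 - pH, so the value does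
not depend on v and equals (p-1)!. -/
theorem toZModPow_two_risingProd_full {h : ℕ} (hh : p = 2 * h + 1) (v : ℤ_[p]) :
    PadicInt.toZModPow 2 (risingProd ((p : ℤ_[p]) * v + 1) (2 * h)) =
      PadicInt.toZModPow 2 ((-1) ^ h * (h.factorial : ℤ_[p]) ^ 2 * (1 - (p : ℤ_[p]) * padicHarmonic p h)) := by
  have e : (p : ℤ_[p]) = 2 * h + 1 := by exact_mod_cast congrArg (Nat.cast (R := ℤ_[p])) hh
  rw [two_mul, risingProd_add,
    show (p : ℤ_[p]) * v + 1 + h = -(p * -(v + 1)) - h by linear_combination -e,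
    risingProd_neg_reflect, map_mul, map_mul, toZModPow_two_risingProd (by omega),
    toZModPow_two_risingProd (by omega)]
  have hε := toZModPow_two_p_sq (p := p)
  simp only [map_mul, map_add, map_one, map_neg, map_pow, map_sub]
  generalize PadicInt.toZModPow 2 (p : ℤ_[p]) = ε at *
  generalize PadicInt.toZModPow 2 (padicHarmonic p h) = H at *
  generalize PadicInt.toZModPow 2 v = v at *
  generalize PadicInt.toZModPow 2 (h.factorial : ℤ_[p]) = f at *
  linear_combination -(-1) ^ h * f ^ 2 * v * (v + 1) * H ^ 2 * hε

/-- The factors pair up as (pv - i)(pv + i) ≡ -i^2. -/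
theorem toZModPow_two_risingProd_central {h : ℕ} (hh : h < p) (v : ℤ_[p]) :
    PadicInt.toZModPow 2 (risingProd ((p : ℤ_[p]) * v - h) h * risingProd ((p : ℤ_[p]) * v + 1) h) =
      PadicInt.toZModPow 2 ((-1) ^ h * (h.factorial : ℤ_[p]) ^ 2) := by
  rw [show (p : ℤ_[p]) * v - h = -(p * -v) - h by ring,
    risingProd_neg_reflect, map_mul, map_mul, toZModPow_two_risingProd hh,
    toZModPow_two_risingProd hh]
  have hε := toZModPow_two_p_sq (p := p)
  simp only [map_mul, map_add, map_one, map_neg, map_pow]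
  generalize PadicInt.toZModPow 2 (p : ℤ_[p]) = ε at *
  generalize PadicInt.toZModPow 2 (padicHarmonic p h) = H at *
  generalize PadicInt.toZModPow 2 v = v at *
  generalize PadicInt.toZModPow 2 (h.factorial : ℤ_[p]) = f at *
  linear_combination -(-1) ^ h * f ^ 2 * v ^ 2 * H ^ 2 * hε

theorem toZModPow_two_factorial {h : ℕ} (hh : p = 2 * h + 1) :
    PadicInt.toZModPow 2 ((2 * h).factorial : ℤ_[p]) =
      PadicInt.toZModPow 2 ((-1) ^ h * (h.factorial : ℤ_[p]) ^ 2 * (1 - (p : ℤ_[p]) * padicHarmonic p h)) := by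
  rw [← toZModPow_two_risingProd_full hh 0, mul_zero, zero_add, risingProd_one]

theorem toZModPow_two_central_eq {h : ℕ} (hh : p = 2 * h + 1) :
    PadicInt.toZModPow 2 ((-1) ^ h * (h.factorial : ℤ_[p]) ^ 2) =
      PadicInt.toZModPow 2 (((2 * h).factorial : ℤ_[p]) * (1 + (p : ℤ_[p]) * padicHarmonic p h)) := by
  rw [map_mul _ ((2 * h).factorial : ℤ_[p]), toZModPow_two_factorial hh]
  have hε := toZModPow_two_p_sq (p := p)
  simp only [map_mul, map_add, map_one, map_neg, map_pow, map_sub]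
  linear_combination (-1) ^ h * (PadicInt.toZModPow 2 (h.factorial : ℤ_[p])) ^ 2 *
    (PadicInt.toZModPow 2 (padicHarmonic p h)) ^ 2 * hε

/-- Each block of p consecutive factors contains one multiple of p, namely p(y + l); `E l` collects
the others. -/
theorem risingProd_mul_length {x y : ℤ_[p]} {E : ℕ → ℤ_[p]}
    (hE : ∀ l : ℕ, risingProd (x + l * p) p = p * (y + l) * E l) (j : ℕ) :
    risingProd x (j * p) = p ^ j * risingProd y j * ∏ l ∈ Finset.range j, E l := by
  induction j with
  | zero => simp
  | succ j ih =>
    rw [Nat.succ_mul, risingProd_add, ih, Nat.cast_mul, hE, risingProd_succ,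
      Finset.prod_range_succ]
    ring

/-- Comparison of `(x)_{jp} / (jp)!` with `(y)_j / j!`, where `y` is the Dwork prime of `x`. -/
theorem toZModPow_two_multichoose_mul {h : ℕ} (hh : p = 2 * h + 1) {x y d : ℤ_[p]}
    {E : ℕ → ℤ_[p]}
    (hE : ∀ l : ℕ, risingProd (x + l * p) p = p * (y + l) * E l)
    (hd : ∀ l, PadicInt.toZModPow 2 (E l) = PadicInt.toZModPow 2 d) (j : ℕ) :
    PadicInt.toZModPow 2 (((2 * h).factorial : ℤ_[p]) ^ j * multichoose x (j * p)) =
      PadicInt.toZModPow 2 (d ^ j * multichoose y j) := by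
  have h1 : ∀ l : ℕ, risingProd ((1 : ℤ_[p]) + l * p) p =
      p * (1 + l) * risingProd ((p : ℤ_[p]) * l + 1) (2 * h) := by
    intro l
    have e : (p : ℤ_[p]) = 2 * h + 1 := by exact_mod_cast congrArg (Nat.cast (R := ℤ_[p])) hh
    conv_lhs => rw [show risingProd ((1 : ℤ_[p]) + l * p) p =
      risingProd ((1 : ℤ_[p]) + l * p) (2 * h + 1) by rw [← hh]]
    rw [risingProd_succ, show (1 : ℤ_[p]) + l * p = p * l + 1 by ring]
    push_cast
    linear_combination -risingProd ((p : ℤ_[p]) * l + 1) (2 * h) * e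
  have e1 := risingProd_mul_length hE j
  have e2 := risingProd_mul_length h1 j
  rw [← factorial_mul_multichoose, ← factorial_mul_multichoose] at e1
  rw [risingProd_one, risingProd_one] at e2
  rw [e2] at e1
  have hne : (p : ℤ_[p]) ^ j * (j.factorial : ℤ_[p]) ≠ 0 :=
    mul_ne_zero (pow_ne_zero _ (Nat.cast_ne_zero.mpr hp.out.ne_zero))
      (Nat.cast_ne_zero.mpr j.factorial_ne_zero)
  -- The power p^j is cancelled in the domain ℤ_p, before reduction mod p^2.
  have e3 : (∏ l ∈ Finset.range j, risingProd ((p : ℤ_[p]) * l + 1) (2 * h)) *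
      multichoose x (j * p) = (∏ l ∈ Finset.range j, E l) * multichoose y j :=
    mul_left_cancel₀ hne (by linear_combination e1)
  have e4 := congrArg (PadicInt.toZModPow 2) e3
  simp only [map_mul, map_prod, hd, toZModPow_two_risingProd_full hh] at e4
  simp only [map_mul, map_pow, toZModPow_two_factorial hh]
  simpa using e4

end ModSq

/-! ### The truncated series at multiples of `p` -/

section TruncatedSeries

open Ring

variable {p : ℕ} [hp : Fact p.Prime]

theorem toZModPow_two_hyperTerm_mul {h : ℕ} (hh : p = 2 * h + 1) {s : ℤ_[p]} (hs : 2 * s = 1)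
    (τ : ℤ_[p]) (j : ℕ) :
    PadicInt.toZModPow 2 (hyperTerm s (p * τ) (j * p)) =
      PadicInt.toZModPow 2 (hyperTerm s τ j * (1 + (p : ℤ_[p]) * (j : ℤ_[p]) * padicHarmonic p h)) := by
  have e : (p : ℤ_[p]) = 2 * h + 1 := by exact_mod_cast congrArg (Nat.cast (R := ℤ_[p])) hh
  -- 1/2 = p/2 - h places the multiple of p in the middle of each block, so 1/2 is its own Dwork
  -- prime. By `toZModPow_two_central_eq` a block differs from (p-1)! by 1 + pH, the source of the
  -- factor 1 + pjH.
  have hsp : s = p * s - h := by linear_combination (-s) * e - (h : ℤ_[p]) * hs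
  have c1 := toZModPow_two_multichoose_mul hh (x := s) (y := s)
    (E := fun l : ℕ => risingProd ((p : ℤ_[p]) * (s + l) - h) h *
      risingProd ((p : ℤ_[p]) * (s + l) + 1) h)
    (d := (-1) ^ h * (h.factorial : ℤ_[p]) ^ 2)
    (fun l => by
      rw [show risingProd (s + l * p) p = risingProd (s + (l : ℤ_[p]) * p) (h + 1 + h) by
        congr 1; omega, risingProd_add, risingProd_succ,
        show s + (l : ℤ_[p]) * p = p * (s + l) - h by linear_combination hsp]
      push_cast
      rw [show (p : ℤ_[p]) * (s + l) - h + (h + 1) = p * (s + l) + 1 by ring]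
      ring)
    (fun l => toZModPow_two_risingProd_central (by omega) _) j
  have c2 := toZModPow_two_multichoose_mul hh (x := -((p : ℤ_[p]) * τ)) (y := -τ)
    (E := fun l : ℕ => risingProd ((p : ℤ_[p]) * (-τ + l) + 1) (2 * h))
    (d := ((2 * h).factorial : ℤ_[p]))
    (fun l => by
      rw [show risingProd (-((p : ℤ_[p]) * τ) + l * p) p =
        risingProd (-((p : ℤ_[p]) * τ) + l * p) (2 * h + 1) by congr 1, risingProd_succ',
        show -((p : ℤ_[p]) * τ) + (l : ℤ_[p]) * p = p * (-τ + l) by ring])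
    (fun l => by
      rw [toZModPow_two_risingProd_full hh, toZModPow_two_factorial hh]) j
  have c3 := toZModPow_two_multichoose_mul hh (x := (p : ℤ_[p]) * τ + 1) (y := τ + 1)
    (E := fun l : ℕ => risingProd ((p : ℤ_[p]) * (τ + l) + 1) (2 * h))
    (d := ((2 * h).factorial : ℤ_[p]))
    (fun l => by
      rw [show risingProd ((p : ℤ_[p]) * τ + 1 + l * p) p =
        risingProd ((p : ℤ_[p]) * τ + 1 + l * p) (2 * h + 1) by congr 1, risingProd_succ,
        show (p : ℤ_[p]) * τ + 1 + (l : ℤ_[p]) * p = p * (τ + l) + 1 by ring]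
      push_cast
      linear_combination -risingProd ((p : ℤ_[p]) * (τ + l) + 1) (2 * h) * e)
    (fun l => by
      rw [toZModPow_two_risingProd_full hh, toZModPow_two_factorial hh]) j
  have hP : IsUnit (PadicInt.toZModPow 2 ((2 * h).factorial : ℤ_[p])) :=
    (isUnit_factorial (by omega)).map _
  have hε := toZModPow_two_p_sq (p := p)
  have hpow : ∀ j : ℕ, (1 + PadicInt.toZModPow 2 (p : ℤ_[p]) *
      PadicInt.toZModPow 2 (padicHarmonic p h)) ^ j =
      1 + PadicInt.toZModPow 2 (p : ℤ_[p]) * j * PadicInt.toZModPow 2 (padicHarmonic p h) := by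
    intro j
    induction j with
    | zero => simp
    | succ j ih =>
      rw [pow_succ _ j, ih]; push_cast
      linear_combination j * (PadicInt.toZModPow 2 (padicHarmonic p h)) ^ 2 * hε
  have K := toZModPow_two_central_eq hh
  rw [map_mul, map_pow, map_mul, map_pow, K, map_mul, map_add, map_one, map_mul _ (p : ℤ_[p]),
    mul_pow, hpow, mul_assoc] at c1
  rw [map_mul, map_pow, map_mul, map_pow] at c2 c3
  have c1 := (hP.pow j).mul_left_cancel c1
  have c2 := (hP.pow j).mul_left_cancel c2
  have c3 := (hP.pow j).mul_left_cancel c3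
  simp only [hyperTerm, map_mul, c1, c2, c3, map_add, map_one, map_natCast]
  ring

/-- The first new factor of (-x)_{k+r+1}, which is k - x, is isolated: at k = jp and x = pτ it
supplies the factor p. -/
theorem risingProd_cube_mul_hyperTerm_add {R : Type*} [CommRing R] [BinomialRing R]
    (s x : R) (k r : ℕ) :
    risingProd ((k : R) + 1) (r + 1) ^ 3 * hyperTerm s x (k + (r + 1)) =
      hyperTerm s x k * (k - x) * (risingProd (s + k) (r + 1) * risingProd (k - x + 1) r *
        risingProd (x + 1 + k) (r + 1)) := by
  have a1 := risingProd_mul_multichoose_add s k (r + 1)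
  have a2 := risingProd_mul_multichoose_add (-x) k (r + 1)
  have a3 := risingProd_mul_multichoose_add (x + 1) k (r + 1)
  rw [risingProd_succ' (-x + _), show -x + (k : R) = k - x by ring] at a2
  generalize risingProd ((k : R) + 1) (r + 1) = Q at *
  calc _ = (Q * multichoose s (k + (r + 1))) * (Q * multichoose (-x) (k + (r + 1))) *
          (Q * multichoose (x + 1) (k + (r + 1))) := by
            rw [hyperTerm]; ring
    _ = _ := by rw [a1, a2, a3, hyperTerm]; ring

theorem toZModPow_two_eq_of_mul {Q z t y : ℤ_[p]} (hQ : IsUnit Q) (key : Q * t = p * z)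
    (hz : PadicInt.toZMod z = PadicInt.toZMod (Q * y)) :
    PadicInt.toZModPow 2 t = PadicInt.toZModPow 2 ((p : ℤ_[p]) * y) := by
  refine (hQ.map (PadicInt.toZModPow 2)).mul_left_cancel ?_
  rw [← map_mul, ← map_mul, key, mul_left_comm]
  exact toZModPow_two_p_mul hz

theorem toZMod_cube_mul {r : ℕ} {Q A B C m w z : ℤ_[p]}
    (ψQ : PadicInt.toZMod Q = (r + 1).factorial)
    (ψA : PadicInt.toZMod A = (r + 1).factorial * PadicInt.toZMod m)
    (ψB : PadicInt.toZMod B = r.factorial) (ψC : PadicInt.toZMod C = (r + 1).factorial)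
    (hw : PadicInt.toZMod (((r : ℤ_[p]) + 1) * w) = PadicInt.toZMod (1 : ℤ_[p])) :
    PadicInt.toZMod (z * (A * B * C)) = PadicInt.toZMod (Q ^ 3 * (z * (m * w))) := by
  simp only [map_mul, map_pow, ψQ, ψA, ψB, ψC, map_add, map_natCast, map_one] at hw ⊢
  rw [Nat.factorial_succ]
  push_cast
  linear_combination (-PadicInt.toZMod z *
    ((r + 1) * r.factorial) ^ 2 * r.factorial * PadicInt.toZMod m) * hw

theorem isUnit_of_toZMod_eq_factorial {k : ℕ} (hk : k < p) {x : ℤ_[p]}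
    (h : PadicInt.toZMod x = k.factorial) : IsUnit x := by
  rw [isUnit_iff_toZMod_ne_zero, h, Ne, ZMod.natCast_eq_zero_iff, hp.out.dvd_factorial]
  omega

theorem toZModPow_two_hyperTerm_add (s τ : ℤ_[p]) (j : ℕ) {r : ℕ} (hr : r + 1 < p) :
    PadicInt.toZModPow 2 (hyperTerm s (p * τ) (j * p + (r + 1))) =
      PadicInt.toZModPow 2 ((p : ℤ_[p]) * (hyperTerm s (p * τ) (j * p) * ((j : ℤ_[p]) - τ) *
        (multichoose s (r + 1) * Ring.inverse ((r : ℤ_[p]) + 1)))) := by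
  have key := risingProd_cube_mul_hyperTerm_add s ((p : ℤ_[p]) * τ) (j * p) r
  have ψQ : PadicInt.toZMod (risingProd (((j * p : ℕ) : ℤ_[p]) + 1) (r + 1)) =
      (r + 1).factorial := by
    rw [map_risingProd, ← risingProd_one]; simp
  have ψA : PadicInt.toZMod (risingProd (s + ((j * p : ℕ) : ℤ_[p])) (r + 1)) =
      (r + 1).factorial * PadicInt.toZMod (multichoose s (r + 1)) := by
    have := congrArg (PadicInt.toZMod (p := p)) (factorial_mul_multichoose s (r + 1))
    rw [map_risingProd, map_mul, map_natCast] at this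
    rw [this, map_risingProd]; simp
  have ψB : PadicInt.toZMod (risingProd (((j * p : ℕ) : ℤ_[p]) - (p : ℤ_[p]) * τ + 1) r) =
      r.factorial := by
    rw [map_risingProd, ← risingProd_one]; simp
  have ψC : PadicInt.toZMod (risingProd ((p : ℤ_[p]) * τ + 1 + ((j * p : ℕ) : ℤ_[p])) (r + 1)) =
      (r + 1).factorial := by
    rw [map_risingProd, ← risingProd_one]; simp
  refine toZModPow_two_eq_of_mul ((isUnit_of_toZMod_eq_factorial hr ψQ).pow 3) ?_
    (toZMod_cube_mul ψQ ψA ψB ψC (congrArg _ (succ_mul_inverse hr)))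
  rw [key]; push_cast; ring

/-- Mod p, 1/2 ≡ -h turns the summands into (-1)^r C(h, r) / r. -/
theorem toZMod_sum_multichoose_half {h : ℕ} (hh : p = 2 * h + 1) {s : ℤ_[p]} (hs : 2 * s = 1) :
    PadicInt.toZMod (∑ r ∈ Finset.range (2 * h),
      multichoose s (r + 1) * Ring.inverse ((r : ℤ_[p]) + 1)) =
        PadicInt.toZMod (-padicHarmonic p h) := by
  have hN : ∀ k < 2 * h, ((k : ZMod p) + 1) ≠ 0 := by
    intro k hk
    have := natCast_zmod_ne_zero (p := p) (Nat.succ_pos k) (by omega)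
    exact_mod_cast this
  have e : (0 : ZMod p) = 2 * h + 1 := by
    rw [← ZMod.natCast_self p]; exact_mod_cast congrArg (Nat.cast (R := ZMod p)) hh
  have hs' := congrArg (PadicInt.toZMod (p := p)) hs
  simp only [map_mul, map_ofNat, map_one] at hs'
  have hψ : PadicInt.toZMod s = PadicInt.toZMod (-(h : ℤ_[p])) := by
    simp only [map_neg, map_natCast]
    linear_combination (-PadicInt.toZMod s) * e - h * hs'
  rw [map_neg, toZMod_padicHarmonic (by omega), ← sum_neg_one_pow_choose_div hN h (by omega),
    map_sum]
  refine Finset.sum_congr rfl fun r hr => ?_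
  have hr := Finset.mem_range.mp hr
  have hm : PadicInt.toZMod (multichoose s (r + 1)) =
      PadicInt.toZMod (multichoose (-(h : ℤ_[p])) (r + 1)) := by
    refine ((isUnit_factorial (p := p) (k := r + 1) (by omega)).map
      PadicInt.toZMod).mul_left_cancel ?_
    rw [← map_mul, ← map_mul, factorial_mul_multichoose, factorial_mul_multichoose,
      map_risingProd, map_risingProd, hψ]
  have hw := congrArg (PadicInt.toZMod (p := p)) (succ_mul_inverse (p := p) (k := r) (by omega))
  simp only [map_mul, map_add, map_natCast, map_one] at hw
  rw [map_mul, hm, multichoose_neg_natCast, eq_div_iff (hN r hr)]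
  simp only [map_mul, map_pow, map_neg, map_one, map_natCast]
  linear_combination (-1) ^ (r + 1) * (h.choose (r + 1) : ZMod p) * hw

/-- In the n-th block the two corrections npH and -p(n-τ)H add up to pτH, independent of n. -/
theorem toZModPow_two_hyperSum_mul {h : ℕ} (hh : p = 2 * h + 1) {s : ℤ_[p]} (hs : 2 * s = 1)
    (τ : ℤ_[p]) (n : ℕ) :
    PadicInt.toZModPow 2 (hyperSum s (p * τ) (n * p)) =
      PadicInt.toZModPow 2 (hyperSum s τ n * (1 + (p : ℤ_[p]) * τ * padicHarmonic p h)) := by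
  induction n with
  | zero => simp [hyperSum]
  | succ n ih =>
    have e1 : hyperSum s (p * τ) ((n + 1) * p) = hyperSum s (p * τ) (n * p) +
        (∑ r ∈ Finset.range (2 * h), hyperTerm s (p * τ) (n * p + (r + 1)) +
          hyperTerm s (p * τ) (n * p)) := by
      rw [hyperSum, Nat.succ_mul, Finset.sum_range_add, hyperSum]
      congr 1
      conv_lhs => rw [show Finset.range p = Finset.range (2 * h + 1) by rw [← hh]]
      rw [Finset.sum_range_succ', add_zero]
    have e2 : hyperSum s τ (n + 1) = hyperSum s τ n + hyperTerm s τ n :=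
      Finset.sum_range_succ _ _
    have e3 : PadicInt.toZModPow 2 (∑ r ∈ Finset.range (2 * h),
        hyperTerm s (p * τ) (n * p + (r + 1))) = PadicInt.toZModPow 2 ((p : ℤ_[p]) *
          (hyperTerm s (p * τ) (n * p) * ((n : ℤ_[p]) - τ) * -padicHarmonic p h)) := by
      have h1 : ∀ r ∈ Finset.range (2 * h), _ := fun r hr =>
        toZModPow_two_hyperTerm_add s τ n (r := r) (by have := Finset.mem_range.mp hr; omega)
      rw [map_sum, Finset.sum_congr rfl h1, ← map_sum, ← Finset.mul_sum, ← Finset.mul_sum]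
      refine toZModPow_two_p_mul ?_
      rw [map_mul, toZMod_sum_multichoose_half hh hs, ← map_mul]
    have e4 := toZModPow_two_hyperTerm_mul hh hs τ n
    have hε := toZModPow_two_p_sq (p := p)
    rw [e1, e2, map_add, map_add, ih, e3]
    simp only [map_mul, map_add, map_sub, map_neg, map_one] at e4 ⊢
    rw [e4]
    linear_combination (-PadicInt.toZModPow 2 (hyperTerm s τ n) *
      PadicInt.toZModPow 2 (n : ℤ_[p]) * PadicInt.toZModPow 2 (padicHarmonic p h) ^ 2 *
      (PadicInt.toZModPow 2 (n : ℤ_[p]) - PadicInt.toZModPow 2 τ)) * hε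

theorem toZModPow_two_hyperSum_shift {s : ℤ_[p]} (hs : 2 * s = 1) (τ : ℤ_[p]) (n : ℕ) {M : ℕ}
    (hM : 2 * M < p) :
    PadicInt.toZModPow 2 ((∏ i ∈ Finset.range M, ((p : ℤ_[p]) * τ + 2 * i + 2)) ^ 2 *
        hyperSum s ((p : ℤ_[p]) * τ + 2 * M) (n * p)) =
      PadicInt.toZModPow 2 ((∏ i ∈ Finset.range M, ((p : ℤ_[p]) * τ + 2 * i + 1)) ^ 2 *
        hyperSum s ((p : ℤ_[p]) * τ) (n * p)) := by
  induction M with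
  | zero => simp
  | succ M ih =>
    have ih := ih (by omega)
    set x := (p : ℤ_[p]) * τ + 2 * M with hx
    have hψ : PadicInt.toZMod x = (2 * M : ℕ) := by simp [hx, map_ofNat]
    -- x ≡ 2M and 2M + 2 < p, so the multiplier in the recurrence is invertible.
    have u1 : IsUnit (x + 1) := by
      rw [isUnit_iff_toZMod_ne_zero, map_add, hψ, map_one]
      exact_mod_cast natCast_zmod_ne_zero (Nat.succ_pos (2 * M)) (by omega)
    have u2 : IsUnit (x + 2) := by
      rw [isUnit_iff_toZMod_ne_zero, map_add, hψ, map_ofNat]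
      exact_mod_cast natCast_zmod_ne_zero (Nat.succ_pos (2 * M + 1)) (by omega)
    have step : PadicInt.toZModPow 2 ((x + 2) ^ 2 * hyperSum s (x + 2) (n * p)) =
        PadicInt.toZModPow 2 ((x + 1) ^ 2 * hyperSum s x (n * p)) := by
      rw [toZModPow_eq_iff]
      have : (p : ℤ_[p]) ^ 2 ∣ (x + 1) * (x + 2) *
          ((x + 2) ^ 2 * hyperSum s (x + 2) (n * p) - (x + 1) ^ 2 * hyperSum s x (n * p)) := by
        rw [hyperSum_recurrence hs]
        refine Dvd.dvd.mul_right (Dvd.dvd.mul_left ?_ _) _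
        exact ⟨n ^ 3 * p, by push_cast; ring⟩
      exact ((u1.mul u2).dvd_mul_left).mp this
    rw [Finset.prod_range_succ, Finset.prod_range_succ,
      show (p : ℤ_[p]) * τ + 2 * ((M + 1 : ℕ) : ℤ_[p]) = x + 2 by rw [hx]; push_cast; ring]
    rw [← hx]
    rw [mul_pow, mul_assoc, map_mul, step, map_mul, mul_left_comm, ← map_mul, ih, ← map_mul]
    congr 1; ring

end TruncatedSeries

/-! ### The `p`-adic Gamma function modulo `p ^ 2` -/

section GammaModSq

open Ring

variable {p : ℕ} [hp : Fact p.Prime]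

/-- Every m near x is congruent to u mod p^2, so `padicGammaNat_congr` confines the values to a
closed ball, which also contains the limit. -/
theorem exists_padicInt_eq_padicGamma (hp2 : p ≠ 2) {x : ℤ_[p]} {u : ℕ}
    (hx : (p : ℤ_[p]) ^ 2 ∣ x - u) :
    ∃ g : ℤ_[p], (g : ℚ_[p]) = padicGamma p (x : ℚ_[p]) ∧
      PadicInt.toZModPow 2 g = PadicInt.toZModPow 2 (padicGammaNat p u : ℤ_[p]) := by
  have hlim := tendsto_padicGamma p hp2 x
  have hne : (Filter.comap (fun m : ℕ => (m : ℚ_[p])) (nhds (x : ℚ_[p]))).NeBot := by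
    rw [Filter.comap_neBot_iff]
    intro t ht
    obtain ⟨ε, hε, hball⟩ := Metric.mem_nhds_iff.mp ht
    obtain ⟨n, hn⟩ := PadicInt.denseRange_natCast.exists_dist_lt x hε
    refine ⟨n, hball ?_⟩
    rw [Metric.mem_ball, dist_comm]
    exact_mod_cast hn
  have hpos : (0 : ℝ) < (p : ℝ) ^ (-(2 : ℕ) : ℤ) := by
    have : (0 : ℝ) < p := by exact_mod_cast hp.out.pos
    positivity
  have hclosed : IsClosed {y : ℚ_[p] | ‖y - (padicGammaNat p u : ℚ_[p])‖ ≤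
      (p : ℝ) ^ (-(2 : ℕ) : ℤ)} :=
    isClosed_le (by fun_prop) continuous_const
  have hmem : ‖padicGamma p (x : ℚ_[p]) - (padicGammaNat p u : ℚ_[p])‖ ≤
      (p : ℝ) ^ (-(2 : ℕ) : ℤ) := by
    refine hclosed.mem_of_tendsto hlim ?_
    filter_upwards [Filter.preimage_mem_comap (Metric.closedBall_mem_nhds (x : ℚ_[p]) hpos)]
      with m hm
    rw [Set.mem_preimage, mem_closedBall_iff_norm] at hm
    have hm' : ‖(m : ℤ_[p]) - x‖ ≤ (p : ℝ) ^ (-(2 : ℕ) : ℤ) := by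
      rw [PadicInt.norm_def]; push_cast; exact_mod_cast hm
    rw [PadicInt.norm_le_pow_iff_mem_span_pow, Ideal.mem_span_singleton] at hm'
    have h1 : (p : ℤ_[p]) ^ 2 ∣ (((m : ℤ) - (u : ℤ) : ℤ) : ℤ_[p]) := by
      have := dvd_add hm' hx
      rw [sub_add_sub_cancel] at this
      push_cast; exact this
    rw [← Ideal.mem_span_singleton, ← PadicInt.norm_le_pow_iff_mem_span_pow,
      PadicInt.norm_int_le_pow_iff_dvd] at h1
    have h2 : m ≡ u [MOD p ^ 2] := (Nat.modEq_iff_dvd.mpr (by exact_mod_cast h1)).symm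
    have h3 := padicGammaNat_congr hp.out hp2 two_ne_zero h2
    rw [← Int.cast_sub]
    exact (Padic.norm_int_le_pow_iff_dvd _ _).mpr (by exact_mod_cast h3)
  have hle : ‖padicGamma p (x : ℚ_[p]) - (padicGammaNat p u : ℚ_[p])‖ ≤ 1 :=
    hmem.trans (zpow_le_one_of_nonpos₀ (by exact_mod_cast hp.out.one_le) (by norm_num))
  let e : ℤ_[p] := ⟨_, hle⟩
  refine ⟨e + (padicGammaNat p u : ℤ_[p]), ?_, ?_⟩
  · rw [PadicInt.coe_add, PadicInt.coe_intCast]; exact sub_add_cancel _ _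
  · rw [toZModPow_eq_iff, add_sub_cancel_right, ← Ideal.mem_span_singleton,
      ← PadicInt.norm_le_pow_iff_mem_span_pow]
    exact hmem

theorem padicGammaNat_add_of_coprime (m M : ℕ) (h : ∀ i < M, Nat.Coprime (m + i) p) :
    (padicGammaNat p (m + M) : ℤ_[p]) =
      padicGammaNat p m * ((-1) ^ M * risingProd (m : ℤ_[p]) M) := by
  rw [padicGammaNat_eq hp.out, padicGammaNat_eq hp.out, Finset.prod_range_add, Int.cast_mul]
  congr 1
  rw [Int.cast_prod, risingProd, ← Finset.card_range M, ← Finset.prod_const, Finset.card_range,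
    ← Finset.prod_mul_distrib]
  refine Finset.prod_congr rfl fun i hi => ?_
  rw [if_pos (h i (Finset.mem_range.mp hi))]
  push_cast; ring

theorem padicGammaNat_mul_add {l M : ℕ} (hM : M < p) :
    (padicGammaNat p (l * p + 1 + M) : ℤ_[p]) =
      padicGammaNat p (l * p) * ((-1) ^ (M + 1) * risingProd ((p : ℤ_[p]) * l + 1) M) := by
  have h1 : padicGammaNat p (l * p + 1) = -padicGammaNat p (l * p) := by
    -- The skipped index lp contributes only a sign.
    rw [padicGammaNat_eq hp.out, padicGammaNat_eq hp.out, Finset.prod_range_succ, if_neg]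
    · ring
    · rw [Nat.coprime_comm, hp.out.coprime_iff_not_dvd, not_not]
      exact Dvd.intro_left l rfl
  rw [padicGammaNat_add_of_coprime, h1]
  · push_cast
    rw [mul_comm (l : ℤ_[p])]
    ring
  · intro i hi
    rw [Nat.coprime_comm, hp.out.coprime_iff_not_dvd, add_assoc,
      Nat.dvd_add_right (Dvd.intro_left l rfl)]
    exact Nat.not_dvd_of_pos_of_lt (by omega) (by omega)

theorem toZModPow_two_padicGammaNat_mul {h : ℕ} (hh : p = 2 * h + 1) (l : ℕ) :
    PadicInt.toZModPow 2 (padicGammaNat p (l * p) : ℤ_[p]) =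
      PadicInt.toZModPow 2 ((-((2 * h).factorial : ℤ_[p])) ^ l) := by
  induction l with
  | zero => simp [padicGammaNat]
  | succ l ih =>
    rw [show (l + 1) * p = l * p + 1 + 2 * h by rw [Nat.succ_mul]; omega,
      padicGammaNat_mul_add (by omega), map_mul, map_mul, toZModPow_two_risingProd_full hh,
      ← toZModPow_two_factorial hh, ih, ← map_mul, ← map_mul, Odd.neg_one_pow ⟨h, rfl⟩]
    congr 1; ring

/-- Wilson's congruence mod p lifts to p^2 on taking p-th powers. -/
theorem toZModPow_two_factorial_pow {h : ℕ} (hh : p = 2 * h + 1) :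
    PadicInt.toZModPow 2 (((2 * h).factorial : ℤ_[p]) ^ p) = -1 := by
  have h1 : PadicInt.toZMod ((2 * h).factorial : ℤ_[p]) = PadicInt.toZMod (-1 : ℤ_[p]) := by
    rw [map_natCast, map_neg, map_one, ← ZMod.wilsons_lemma p, show p - 1 = 2 * h by omega]
  rw [toZMod_eq_iff] at h1
  have h2 := dvd_sub_pow_of_dvd_sub h1 1
  rw [pow_one, ← toZModPow_eq_iff, (hp.out.odd_of_ne_two (by omega)).neg_one_pow, map_neg,
    map_one] at h2
  exact h2

/-- The square of `Γ_p(-pτ/2) Γ_p((1 + pτ)/2)` modulo `p ^ 2`, in terms of factorials. -/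
theorem toZModPow_two_gamma_sq {h : ℕ} (hh : p = 2 * h + 1) {τ : ℤ_[p]} {U V : ℕ}
    (hUV : U + V = h + 2 * p) (hV : PadicInt.toZMod (2 * (V : ℤ_[p])) = PadicInt.toZMod (τ - 1)) :
    PadicInt.toZModPow 2 (((2 * h).factorial : ℤ_[p]) ^ (2 * (U + V)) *
        risingProd ((p : ℤ_[p]) * V + 1) h ^ 2) =
      PadicInt.toZModPow 2 ((-1) ^ (h + 1) * (1 + (p : ℤ_[p]) * τ * padicHarmonic p h)) := by
  have hP : IsUnit (PadicInt.toZModPow 2 ((2 * h).factorial : ℤ_[p])) :=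
    (isUnit_factorial (by omega)).map _
  refine hP.mul_left_cancel ?_
  -- U + V = h + 2p makes the total exponent 2(U+V) + 1 = 5p.
  have e1 : PadicInt.toZModPow 2 (((2 * h).factorial : ℤ_[p]) *
      ((2 * h).factorial : ℤ_[p]) ^ (2 * (U + V))) = -1 := by
    rw [← pow_succ', show 2 * (U + V) + 1 = p * 5 by omega, pow_mul, map_pow,
      toZModPow_two_factorial_pow hh]
    norm_num
  have e2 := toZModPow_two_central_eq hh
  have e3 := toZModPow_two_p_mul hV
  have e4 := toZModPow_two_risingProd (p := p) (h := h) (by omega) (V : ℤ_[p])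
  have hε := toZModPow_two_p_sq (p := p)
  have h1 : ((-1 : ZMod (p ^ 2)) ^ h) ^ 2 = 1 := by rw [← pow_mul, mul_comm, pow_mul]; simp
  rw [← map_mul, ← mul_assoc, map_mul, e1, map_pow, e4]
  simp only [map_mul, map_add, map_one, map_neg, map_pow, map_sub, map_ofNat] at e2 e3 ⊢
  rw [pow_succ (-1 : ZMod (p ^ 2)) h]
  generalize (-1 : ZMod (p ^ 2)) ^ h = c at *
  generalize PadicInt.toZModPow 2 (p : ℤ_[p]) = ε at *
  generalize PadicInt.toZModPow 2 (padicHarmonic p h) = H at *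
  generalize PadicInt.toZModPow 2 (V : ℤ_[p]) = v at *
  generalize PadicInt.toZModPow 2 τ = t at *
  generalize PadicInt.toZModPow 2 (h.factorial : ℤ_[p]) = f at *
  generalize PadicInt.toZModPow 2 ((2 * h).factorial : ℤ_[p]) = P at *
  linear_combination (-(1 + ε * v * H) ^ 2) * (c * e2 - f ^ 2 * h1) -
    c * P * (1 + ε * H) * (H * e3 + v ^ 2 * H ^ 2 * hε) - c * P * H ^ 2 * (t - 1) * hε

/-- The final elimination: N₁, N₂ are the shift products, G₁, G₂ the Gamma values, A₁, A₂ their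
values at multiples of p, m = 2^M, and T = 1 + pτH. Only squares occur, so σ drops out. -/
theorem mul_sq_eq_of_gamma_relations {R : Type*} [CommRing R]
    {N₁ N₂ G₁ G₂ A₁ A₂ σ B m r₁ r₂ S T c : R} (k₁ : A₁ = G₁ * r₁) (n₁ : m * r₁ = N₁)
    (k₂ : G₂ = A₂ * (σ * (B * r₂))) (n₂ : m * r₂ = N₂) (hσ : σ ^ 2 = 1)
    (hT : A₁ ^ 2 * A₂ ^ 2 * B ^ 2 = c * T) (hc : c ^ 2 = 1) :
    N₂ ^ 2 * (S * T) = N₁ ^ 2 * (c * G₁ ^ 2 * G₂ ^ 2 * S) := by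
  subst k₁ n₁ k₂ n₂
  linear_combination (-c * S * m ^ 2 * r₂ ^ 2) * hT - m ^ 2 * r₂ ^ 2 * S * T * hc -
    c * S * m ^ 2 * r₂ ^ 2 * G₁ ^ 2 * r₁ ^ 2 * A₂ ^ 2 * B ^ 2 * hσ

theorem toZModPow_two_hyperSum_gamma {h : ℕ} (hh : p = 2 * h + 1) {s : ℤ_[p]} (hs : 2 * s = 1)
    {α τ : ℤ_[p]} {M : ℕ} (hM : 2 * M < p) (hα : α = p * τ + 2 * M)
    (n : ℕ) (hn : hyperSum s α n = hyperSum s τ n) :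
    ∃ g₁ g₂ : ℤ_[p], (g₁ : ℚ_[p]) = padicGamma p ((-(s * α) : ℤ_[p]) : ℚ_[p]) ∧
      (g₂ : ℚ_[p]) = padicGamma p ((s * (α + 1) : ℤ_[p]) : ℚ_[p]) ∧
      PadicInt.toZModPow 2 (hyperSum s α (n * p)) =
        PadicInt.toZModPow 2 ((-1) ^ (h + 1) * g₁ ^ 2 * g₂ ^ 2 * hyperSum s α n) := by
  have e : (p : ℤ_[p]) = 2 * h + 1 := by exact_mod_cast congrArg (Nat.cast (R := ℤ_[p])) hh
  have hp2 : p ≠ 2 := by omega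
  -- U ≡ -τ/2 and V ≡ (τ-1)/2 mod p, so U + V ≡ -1/2 ≡ h. Adding p to the residue U keeps Up - M
  -- nonnegative. Then -α/2 ≡ Up - M and (α+1)/2 ≡ Vp + 1 + h + M mod p^2.
  obtain ⟨U, V, hU1, hUV, hU⟩ : ∃ U V : ℕ, p ≤ U ∧ U + V = h + 2 * p ∧
      PadicInt.toZMod (2 * (U : ℤ_[p])) = PadicInt.toZMod (-τ) := by
    have : NeZero p := ⟨hp.out.ne_zero⟩
    have hlt := ZMod.val_lt (PadicInt.toZMod (-(s * τ)))
    refine ⟨(PadicInt.toZMod (-(s * τ))).val + p, h + 2 * p -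
      ((PadicInt.toZMod (-(s * τ))).val + p), by omega, by omega, ?_⟩
    have hs' := congrArg (PadicInt.toZMod (p := p)) hs
    rw [map_mul, map_natCast, Nat.cast_add, ZMod.natCast_self, add_zero, ZMod.natCast_val,
      ZMod.cast_id]
    simp only [map_mul, map_ofNat, map_one, map_neg] at hs' ⊢
    linear_combination (-PadicInt.toZMod τ) * hs'
  have eUV : (U : ℤ_[p]) + V = h + 2 * p := by
    exact_mod_cast congrArg (Nat.cast (R := ℤ_[p])) hUV
  have hV : PadicInt.toZMod (2 * (V : ℤ_[p])) = PadicInt.toZMod (τ - 1) := by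
    rw [toZMod_eq_iff] at hU ⊢
    have : 2 * (V : ℤ_[p]) - (τ - 1) = p * 5 - (2 * (U : ℤ_[p]) - -τ) := by
      linear_combination 2 * eUV - e
    rw [this]
    exact dvd_sub (Dvd.intro _ rfl) hU
  obtain ⟨u, hu⟩ : ∃ u, u + M = U * p :=
    ⟨U * p - M, Nat.sub_add_cancel (by nlinarith [hp.out.one_le])⟩
  have eu : (u : ℤ_[p]) + M = U * p := by exact_mod_cast congrArg (Nat.cast (R := ℤ_[p])) hu
  have d1 : (p : ℤ_[p]) ^ 2 ∣ -(s * α) - u := by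
    rw [toZMod_eq_iff] at hU
    have : -(s * α) - u = -(s * (p * (2 * (U : ℤ_[p]) - -τ))) := by
      linear_combination -s * hα + (-(M : ℤ_[p]) + u + M) * hs - 2 * s * eu
    rw [this, sq]
    exact (Dvd.dvd.mul_left (mul_dvd_mul_left _ hU) _).neg_right
  have d2 : (p : ℤ_[p]) ^ 2 ∣ s * (α + 1) - (V * p + 1 + (h + M) : ℕ) := by
    rw [toZMod_eq_iff] at hV
    have : s * (α + 1) - (V * p + 1 + (h + M) : ℕ) =
        -(s * (p * (2 * (V : ℤ_[p]) - (τ - 1)))) := by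
      push_cast
      linear_combination s * hα + ((V : ℤ_[p]) * p + 1 + h + M) * hs + s * e
    rw [this, sq]
    exact (Dvd.dvd.mul_left (mul_dvd_mul_left _ hV) _).neg_right
  obtain ⟨g₁, hg₁, hγ₁⟩ := exists_padicInt_eq_padicGamma hp2 d1
  obtain ⟨g₂, hg₂, hγ₂⟩ := exists_padicInt_eq_padicGamma hp2 d2
  refine ⟨g₁, g₂, hg₁, hg₂, ?_⟩
  have k1 := padicGammaNat_add_of_coprime (p := p) u M (fun i hi => by
    rw [Nat.coprime_comm, hp.out.coprime_iff_not_dvd]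
    intro hd
    have h1 : p ∣ (u + i) + (M - i) := by
      rw [show u + i + (M - i) = U * p by omega]; exact Dvd.intro_left U rfl
    rw [Nat.dvd_add_right hd] at h1
    exact Nat.not_dvd_of_pos_of_lt (by omega) (by omega) h1)
  have k2 := padicGammaNat_mul_add (p := p) (l := V) (M := h + M) (by omega)
  rw [hu, show (u : ℤ_[p]) = -(-((U : ℤ_[p]) * p)) - M by linear_combination eu,
    risingProd_neg_reflect, ← mul_assoc ((-1) ^ M), ← mul_pow, neg_one_mul, neg_neg, one_pow,
    one_mul] at k1
  rw [risingProd_add] at k2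
  have n1 : PadicInt.toZModPow 2 (2 ^ M * risingProd (-((U : ℤ_[p]) * p) + 1) M) =
      PadicInt.toZModPow 2 (∏ i ∈ Finset.range M, ((p : ℤ_[p]) * τ + 2 * (i : ℤ_[p]) + 2)) := by
    have : (2 : ℤ_[p]) ^ M = ∏ _i ∈ Finset.range M, (2 : ℤ_[p]) := by simp
    rw [risingProd, this, ← Finset.prod_mul_distrib, map_prod, map_prod]
    refine Finset.prod_congr rfl fun i _ => ?_
    have := toZModPow_two_p_mul hU
    simp only [map_mul, map_add, map_neg, map_natCast, map_ofNat, map_one] at this ⊢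
    linear_combination -this
  have n2 : PadicInt.toZModPow 2 (2 ^ M * risingProd ((p : ℤ_[p]) * V + 1 + h) M) =
      PadicInt.toZModPow 2 (∏ i ∈ Finset.range M, ((p : ℤ_[p]) * τ + 2 * (i : ℤ_[p]) + 1)) := by
    have : (2 : ℤ_[p]) ^ M = ∏ _i ∈ Finset.range M, (2 : ℤ_[p]) := by simp
    rw [risingProd, this, ← Finset.prod_mul_distrib, map_prod, map_prod]
    refine Finset.prod_congr rfl fun i _ => ?_
    have := toZModPow_two_p_mul hV
    have e' := congrArg (PadicInt.toZModPow 2) e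
    simp only [map_mul, map_add, map_sub, map_natCast, map_ofNat, map_one] at this e' ⊢
    linear_combination this - e'
  have hN1 : IsUnit (∏ i ∈ Finset.range M, ((p : ℤ_[p]) * τ + 2 * (i : ℤ_[p]) + 2)) := by
    rw [IsUnit.prod_iff]
    intro i hi
    have := Finset.mem_range.mp hi
    rw [isUnit_iff_toZMod_ne_zero]
    have h1 : PadicInt.toZMod ((p : ℤ_[p]) * τ + 2 * (i : ℤ_[p]) + 2) = ((2 * i + 2 : ℕ) : ZMod p) := by
      simp [map_ofNat]
    rw [h1]
    exact natCast_zmod_ne_zero (by omega) (by omega)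
  have k1 := congrArg (PadicInt.toZModPow 2) k1
  have k2 := congrArg (PadicInt.toZModPow 2) k2
  rw [toZModPow_two_padicGammaNat_mul hh, map_mul, ← hγ₁, map_pow] at k1
  rw [← hγ₂, map_mul, toZModPow_two_padicGammaNat_mul hh, map_pow] at k2
  have gs := toZModPow_two_gamma_sq hh hUV hV
  have sh := toZModPow_two_hyperSum_shift hs τ n hM
  have sm := toZModPow_two_hyperSum_mul hh hs τ n
  rw [← hα] at sh
  refine ((hN1.pow 2).map (PadicInt.toZModPow 2)).mul_left_cancel ?_
  rw [← map_mul, sh, hn]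
  have hsgn : ∀ k : ℕ, ((-1 : ZMod (p ^ 2)) ^ k) ^ 2 = 1 := fun k => by
    rw [← pow_mul, mul_comm, pow_mul]; simp
  have s1 := hsgn (h + 1)
  have s2 := hsgn (h + M + 1)
  have s3 : ∀ P : ZMod (p ^ 2), ((-P) ^ U) ^ 2 * ((-P) ^ V) ^ 2 = P ^ (2 * (U + V)) := fun P => by
    rw [← mul_pow, ← pow_add, ← pow_mul, mul_comm, pow_mul, neg_sq, ← pow_mul]
  have s4 := s3 (PadicInt.toZModPow 2 ((2 * h).factorial : ℤ_[p]))
  simp only [map_mul, map_pow, map_add, map_neg, map_one] at k1 k2 gs sm n1 n2 ⊢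
  rw [sm]
  exact mul_sq_eq_of_gamma_relations k1 n1 k2 n2 s2 (s4 ▸ gs) s1

end GammaModSq

/-! ### Transfer to rational parameters -/

section Transfer

open Ring

variable {p : ℕ} [hp : Fact p.Prime]

theorem coe_risingProd (x : ℤ_[p]) (k : ℕ) :
    ((risingProd x k : ℤ_[p]) : ℚ_[p]) = risingProd (x : ℚ_[p]) k :=
  map_risingProd PadicInt.Coe.ringHom x k

theorem coe_multichoose_eq {x : ℤ_[p]} {q : ℚ} (hx : (x : ℚ_[p]) = q) (k : ℕ) :
    ((multichoose x k : ℤ_[p]) : ℚ_[p]) =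
      (((ascPochhammer ℚ k).eval q / (k.factorial : ℚ) : ℚ) : ℚ_[p]) := by
  have h1 := congrArg (fun y : ℤ_[p] => (y : ℚ_[p])) (factorial_mul_multichoose x k)
  have h2 : ((risingProd q k : ℚ) : ℚ_[p]) = risingProd (q : ℚ_[p]) k :=
    map_risingProd (Rat.castHom ℚ_[p]) q k
  simp only [PadicInt.coe_mul, PadicInt.coe_natCast, coe_risingProd, hx] at h1
  have hne : (k.factorial : ℚ_[p]) ≠ 0 := Nat.cast_ne_zero.mpr k.factorial_ne_zero
  rw [ascPochhammer_eval_eq_risingProd]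
  push_cast
  rw [h2, eq_div_iff hne, mul_comm, h1]

theorem coe_half {s : ℤ_[p]} (hs : 2 * s = 1) : (s : ℚ_[p]) = 1 / 2 := by
  have h : ((2 * s : ℤ_[p]) : ℚ_[p]) = ((1 : ℤ_[p]) : ℚ_[p]) := by rw [hs]
  rw [PadicInt.coe_mul, PadicInt.coe_one, show ((2 : ℤ_[p]) : ℚ_[p]) = 2 from rfl] at h
  linear_combination h / 2

theorem coe_hyperSum_eq {s α : ℤ_[p]} {a : ℚ} (hs : 2 * s = 1) (hα : (α : ℚ_[p]) = a) (N : ℕ) :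
    ((hyperSum s α N : ℤ_[p]) : ℚ_[p]) =
      ((truncatedHypergeometric [1 / 2, -a, a + 1] [1, 1] 1 N : ℚ) : ℚ_[p]) := by
  have hs' : (s : ℚ_[p]) = ((1 / 2 : ℚ) : ℚ_[p]) := by
    rw [coe_half hs]; norm_num
  rw [hyperSum, truncatedHypergeometric, PadicInt.coe_sum, Rat.cast_sum]
  refine Finset.sum_congr rfl fun k _ => ?_
  rw [hyperTerm, PadicInt.coe_mul, PadicInt.coe_mul, coe_multichoose_eq hs',
    coe_multichoose_eq (q := -a) (by push_cast; rw [hα]),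
    coe_multichoose_eq (q := a + 1) (by push_cast; rw [hα]), ← Rat.cast_mul, ← Rat.cast_mul]
  congr 1
  have h1 : (ascPochhammer ℚ k).eval 1 = k.factorial := by
    rw [ascPochhammer_eval_eq_risingProd, risingProd_one]
  simp only [List.map_cons, List.map_nil, List.prod_cons, List.prod_nil, h1, one_pow, mul_one]
  have hne : (k.factorial : ℚ) ≠ 0 := Nat.cast_ne_zero.mpr k.factorial_ne_zero
  field_simp

theorem padicCongr_coe_iff (m : ℕ) (x y : ℤ_[p]) :
    PadicCongr p m (x : ℚ_[p]) (y : ℚ_[p]) ↔ (p : ℤ_[p]) ^ m ∣ x - y := by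
  constructor
  · rintro ⟨u, v, hu, hv, h⟩
    rwa [Subtype.coe_injective hu, Subtype.coe_injective hv] at h
  · exact fun h => ⟨x, y, rfl, rfl, h⟩

theorem leastResidue_eq {x : ℤ_[p]} {m : ℕ} (hm : m < p) (h : (p : ℤ_[p]) ∣ x - m) :
    leastResidue p (x : ℚ_[p]) = m := by
  have key : ∀ r : ℕ, PadicCongr p 1 (x : ℚ_[p]) (r : ℚ_[p]) ↔ (p : ℤ_[p]) ∣ x - r := by
    intro r
    rw [← PadicInt.coe_natCast, padicCongr_coe_iff, pow_one]
  refine IsLeast.csInf_eq ⟨(key m).mpr h, fun r hr => ?_⟩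
  have hr := (key r).mp hr
  rw [← toZMod_eq_iff] at h hr
  rw [h, map_natCast, map_natCast, ZMod.natCast_eq_natCast_iff', Nat.mod_eq_of_lt hm] at hr
  rw [hr]
  exact Nat.mod_le r p

/-- The Dwork prime of `-1/d` for `p ≡ ±1 (mod d)`. -/
theorem exists_dwork_prime {d : ℕ} (hd : 1 < d) (hmod : p % d = 1 ∨ (p + 1) % d = 0)
    {α : ℤ_[p]} (hα : (d : ℤ_[p]) * α = -1) :
    ∃ (τ : ℤ_[p]) (m : ℕ), m < p ∧ α = p * τ + m ∧ (τ = α ∨ τ = -1 - α) := by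
  have hd0 : (d : ℤ_[p]) ≠ 0 := Nat.cast_ne_zero.mpr (by omega)
  rcases hmod with h | h
  · obtain ⟨k, hk⟩ : ∃ k, p = d * k + 1 := ⟨p / d, by have := Nat.div_add_mod p d; omega⟩
    -- For α = -1/d, (1 - p)α = (p-1)/d = k.
    refine ⟨α, k, by nlinarith, mul_left_cancel₀ hd0 ?_, Or.inl rfl⟩
    have e : (p : ℤ_[p]) = d * k + 1 := by exact_mod_cast congrArg (Nat.cast (R := ℤ_[p])) hk
    linear_combination (1 - p) * hα + e
  · obtain ⟨k, hk⟩ := Nat.dvd_of_mod_eq_zero h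
    have hk1 : 0 < k := Nat.pos_of_ne_zero (by rintro rfl; omega)
    have hkp : k ≤ p := by nlinarith
    -- Here (1 + p)α = -(p+1)/d = -k.
    refine ⟨-1 - α, p - k, by omega, mul_left_cancel₀ hd0 ?_, Or.inr rfl⟩
    have e : (p : ℤ_[p]) + 1 = d * k := by exact_mod_cast congrArg (Nat.cast (R := ℤ_[p])) hk
    rw [Nat.cast_sub hkp]
    linear_combination (1 + p) * hα - e

/-- The condition on d and p makes d a p-adic unit; the alternative d = p + 1 admits d = 6, p = 5.
-/
theorem padicCongr_neg_one_div (hp5 : 5 ≤ p) (n : ℕ) {d : ℕ} {a : ℚ}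
    (hda : (d : ℚ) * a = -1) (hd : 1 < d) (hdp : d < p ∨ d = p + 1)
    (hmod : p % d = 1 ∨ (p + 1) % d = 0) (heven : Even (leastResidue p (a : ℚ_[p]))) :
    PadicCongr p 2
      ((truncatedHypergeometric [1 / 2, -a, a + 1] [1, 1] 1 (n * p) : ℚ) : ℚ_[p])
      ((-1 : ℚ_[p]) ^ ((p + 1) / 2) *
        padicGamma p (-(a : ℚ_[p]) / 2) ^ 2 * padicGamma p (((a : ℚ_[p]) + 1) / 2) ^ 2 *
        ((truncatedHypergeometric [1 / 2, -a, a + 1] [1, 1] 1 n : ℚ) : ℚ_[p])) := by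
  obtain ⟨h, hh⟩ := hp.out.odd_of_ne_two (by omega)
  have hdu : IsUnit (d : ℤ_[p]) := by
    rw [isUnit_iff_toZMod_ne_zero, map_natCast, Ne, ZMod.natCast_eq_zero_iff]
    rintro ⟨k, hk⟩
    have h1 : p ∣ d := ⟨k, hk⟩
    rcases hdp with h2 | h2
    · exact Nat.not_dvd_of_pos_of_lt (by omega) h2 h1
    · rw [h2, Nat.dvd_add_right dvd_rfl, Nat.dvd_one] at h1
      omega
  obtain ⟨δ, hδ⟩ := hdu.exists_right_inv
  obtain ⟨s, hs⟩ : ∃ s : ℤ_[p], 2 * s = 1 := by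
    have := isUnit_natCast (p := p) (k := 2) (by omega) (by omega)
    exact_mod_cast this.exists_right_inv
  have hα : (d : ℤ_[p]) * -δ = -1 := by rw [mul_neg, hδ]
  generalize -δ = α at hα
  have hαa : (α : ℚ_[p]) = a := by
    have h1 := congrArg (fun y : ℤ_[p] => (y : ℚ_[p])) hα
    have h2 := congrArg (Rat.cast (K := ℚ_[p])) hda
    push_cast at h1 h2
    refine mul_left_cancel₀ (a := (d : ℚ_[p])) (Nat.cast_ne_zero.mpr (by omega)) ?_
    rw [h1, h2]
  obtain ⟨τ, m, hm, hατ, hτ⟩ := exists_dwork_prime hd hmod hα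
  rw [← hαa, leastResidue_eq hm ⟨τ, by rw [hατ]; ring⟩] at heven
  obtain ⟨M, hM⟩ := even_iff_two_dvd.mp heven
  subst hM
  have hsum : hyperSum s α n = hyperSum s τ n := by
    rcases hτ with rfl | rfl
    · rfl
    · rw [hyperSum_reflect]
  push_cast at hατ
  obtain ⟨g₁, g₂, hg₁, hg₂, key⟩ := toZModPow_two_hyperSum_gamma hh hs hm hατ n hsum
  have hs' := coe_half hs
  rw [← coe_hyperSum_eq hs hαa, ← coe_hyperSum_eq hs hαa,
    show -(a : ℚ_[p]) / 2 = ((-(s * α) : ℤ_[p]) : ℚ_[p]) by push_cast; rw [hs', hαa]; ring,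
    show ((a : ℚ_[p]) + 1) / 2 = ((s * (α + 1) : ℤ_[p]) : ℚ_[p]) by
      push_cast; rw [hs', hαa]; ring,
    ← hg₁, ← hg₂, show (p + 1) / 2 = h + 1 by omega]
  rw [toZModPow_eq_iff, ← padicCongr_coe_iff] at key
  push_cast at key
  exact key

end Transfer

/-! ### The four parameters: p ≡ ±1 modulo 2, 3, 4 and 6 -/

theorem theorem1p2 (p : ℕ) [Fact p.Prime] (hp : 5 ≤ p) (n : ℕ) (hn : 1 ≤ n) (a : ℚ)
    (ha : a ∈ ({-1 / 2, -1 / 3, -1 / 4, -1 / 6} : Set ℚ))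
    (heven : Even (leastResidue p (a : ℚ_[p]))) :
    PadicCongr p 2
      ((truncatedHypergeometric [1 / 2, -a, a + 1] [1, 1] 1 (n * p) : ℚ) : ℚ_[p])
      ((-1 : ℚ_[p]) ^ ((p + 1) / 2) *
        padicGamma p (-(a : ℚ_[p]) / 2) ^ 2 * padicGamma p (((a : ℚ_[p]) + 1) / 2) ^ 2 *
        ((truncatedHypergeometric [1 / 2, -a, a + 1] [1, 1] 1 n : ℚ) : ℚ_[p])) := by
  have hprime : p.Prime := Fact.out
  have h2 : p % 2 ≠ 0 := fun h => by
    have := (Nat.prime_dvd_prime_iff_eq Nat.prime_two hprime).mp (Nat.dvd_of_mod_eq_zero h)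
    omega
  have h3 : p % 3 ≠ 0 := fun h => by
    have := (Nat.prime_dvd_prime_iff_eq Nat.prime_three hprime).mp (Nat.dvd_of_mod_eq_zero h)
    omega
  simp only [Set.mem_insert_iff, Set.mem_singleton_iff] at ha
  have key : ∃ d : ℕ, (d : ℚ) * a = -1 ∧ 1 < d ∧ (d < p ∨ d = p + 1) ∧
      (p % d = 1 ∨ (p + 1) % d = 0) := by
    rcases ha with rfl | rfl | rfl | rfl
    · exact ⟨2, by norm_num, by omega, by omega, by omega⟩
    · exact ⟨3, by norm_num, by omega, by omega, by omega⟩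
    · exact ⟨4, by norm_num, by omega, by omega, by omega⟩
    · have h6 : p % 6 = 1 ∨ p % 6 = 5 := by
        have e2 := Nat.mod_mod_of_dvd p (show 2 ∣ 6 by norm_num)
        have e3 := Nat.mod_mod_of_dvd p (show 3 ∣ 6 by norm_num)
        have := Nat.mod_lt p (show 0 < 6 by norm_num)
        interval_cases p % 6 <;> omega
      exact ⟨6, by norm_num, by omega, by omega, by omega⟩
  obtain ⟨d, hda, hd, hdp, hmod⟩ := key
  exact padicCongr_neg_one_div hp n hda hd hdp hmod heven
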